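/- Let $S=\kappa[x_1,\dots,x_r]$ be a polynomial ring over a field $\kappa$ and $I\subseteq S$ a monomial ideal. Write $\operatorname{mingens}(I)$ for its minimal monomial generators, $\gcd(I)$ for the greatest common divisor of the monomials in $I$, and $\mathbb L_I$ for the lcm lattice of $I$, i.e. the set of all least common multiples of finite subsets of $\operatorname{mingens}(I)$ (including $1=\operatorname{lcm}(\emptyset)$). For $\mathbf n=x^{c}\in\operatorname{mingens}(I)$ and $\gcd(I)=x^{g}$ let $$C_I(\mathbf n)=\{x^{d} : d\in\mathbb N^r,\ d\neq 0,\ d_i\ge c_i \text{ for all } i\in\operatorname{Supp}(c-g),\ d_i<c_i\text{ for some } i\notin\operatorname{Supp}(c-g)\}.$$ For a finite simplicial complex $\Delta$ (with the empty set as a face) whose vertices are labeled with monomials, label each face $\sigma$ with the lcm $\operatorname{lcm}(\sigma)$ of the labels of its vertices, and for a monomial $\mathbf u$ put $\Delta_{\le\mathbf u}=\{\sigma\in\Delta : \operatorname{lcm}(\sigma)\mid\mathbf u\}$ and $\Delta_{<\mathbf u}=\{\sigma\in\Delta_{\le \mathbf u} : \operatorname{lcm}(\sigma)\ne\mathbf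 u\}$. Fix a total order of the vertices. The homogenized chain complex $\mathbb F_\Delta$ has in homological degree $i\ge 0$ the free $S$-module on the faces with $i$ vertices, and differential $e_\tau\mapsto\sum_{v\in\tau}\pm\frac{\operatorname{lcm}(\tau)}{\operatorname{lcm}(\tau\setminus v)}\,e_{\tau\setminus v}$ with the usual simplicial signs. $\Delta$ *supports a free resolution of* $I$ if $\mathbb F_\Delta$ is a free resolution of $S/I$, and it supports a *minimal* one if moreover the image of every differential of $\mathbb F_\Delta$ lies in $(x_1,\dots,x_r)\mathbb F_\Delta$. **Theorem.** Let $\mathbf n\in\operatorname{mingens}(I)$ and $\mathbf m\in C_I(\mathbf n)$ with $\mathbf m\mid\mathbf n$. Let $\Delta$ be a finite simplicial complex whose vertices are labeled with monomials that generate $I$, and let $\Gamma$ be the same complex as $\Delta$ with the vertex label $\mathbf n$ replaced by $\mathbf m$ (wherever it occurs). Then: 1. $\mathbb L_I\setminus\{\mathbf n\}=\mathbb L_{I+(\mathbf m)}\setminus\{\mathbf m\}$, and for every $\mathbf u$ in this set $\Delta_{\le\mathbf u}=\Gamma_{\le\mathbf u}$ and $\Delta_{<\mathbf u}=\Gamma_{<\mathbf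 u}$. 2. $\Delta$ supports a free resolution of $I$ if and only if $\Gamma$ supports a free resolution of $I+(\mathbf m)$; and $\Delta$ supports a minimal free resolution of $I$ if and only if $\Gamma$ supports a minimal free resolution of $I+(\mathbf m)$. -/

import Mathlib

noncomputable section

namespace MonomialResolution

open MvPolynomial

/-!
Throughout, `S = κ[x_1, …, x_r]` is `MvPolynomial (Fin r) κ`, and a monomial `x^u` of `S` is identified
with its exponent vector `u : Fin r →₀ ℕ`. Thus `x^u ∣ x^v` is `u ≤ v`, the lcm of two monomials is
`u ⊔ v`, the monomial `1` is `0`, and the lcm of a finite set `A` of monomials is `A.sup id`.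
-/

section Monomials

variable {κ : Type*} [Field κ] {r : ℕ}

/-- `I` is a monomial ideal: it is generated by monomials. -/
def IsMonomialIdeal (I : Ideal (MvPolynomial (Fin r) κ)) : Prop :=
  ∃ A : Set (Fin r →₀ ℕ), I = Ideal.span ((fun u => monomial u (1 : κ)) '' A)

/-- The set of (exponents of) monomials lying in `I`. -/
def monomialsOf (I : Ideal (MvPolynomial (Fin r) κ)) : Set (Fin r →₀ ℕ) :=
  {u | monomial u (1 : κ) ∈ I}

/-- The minimal monomial generators of `I`: the monomials of `I` that are minimal with respect to
divisibility. -/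
def minGens (I : Ideal (MvPolynomial (Fin r) κ)) : Set (Fin r →₀ ℕ) :=
  {u | Minimal (· ∈ monomialsOf I) u}

/-- The lcm lattice of `I`: all lcm's of finite sets of minimal generators, including
`1 = lcm(∅)`. -/
def lcmLattice (I : Ideal (MvPolynomial (Fin r) κ)) : Set (Fin r →₀ ℕ) :=
  {u | ∃ A : Finset (Fin r →₀ ℕ), (A : Set (Fin r →₀ ℕ)) ⊆ minGens I ∧ A.sup id = u}

/-- `gcd(I)`, the greatest common divisor of all monomials of the nonzero monomial ideal `I`: the
exponent of `x_i` is the least exponent of `x_i` in a monomial of `I`. -/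
def gcdIdeal (I : Ideal (MvPolynomial (Fin r) κ)) : Fin r →₀ ℕ :=
  Finsupp.equivFunOnFinite.symm fun i => sInf ((fun u : Fin r →₀ ℕ => u i) '' monomialsOf I)

/-- The set `C_g(c)` of the nonzero `d` with `d_i ≥ c_i` for all `i ∈ Supp(c - g)` and `d_i < c_i` for
some `i ∉ Supp(c - g)` (used for `g ≤ c`). -/
def CSet (g c : Fin r →₀ ℕ) : Set (Fin r →₀ ℕ) :=
  {d | d ≠ 0 ∧ (∀ i ∈ (c - g).support, c i ≤ d i) ∧ ∃ i ∉ (c - g).support, d i < c i}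

/-- `C_I(n) = C_{gcd(I)}(n)`. -/
def CIdeal (I : Ideal (MvPolynomial (Fin r) κ)) (n : Fin r →₀ ℕ) : Set (Fin r →₀ ℕ) :=
  CSet (gcdIdeal I) n

end Monomials

section Resolutions

universe u v w

/-- The sequence `⋯ → F 2 → F 1 → F 0` with maps `d i : F (i + 1) → F i` is a (finite) free resolution
of the `R`-module `M`: the `F i` are free of finite rank and vanish for large `i`, the sequence is
exact at `F i` for all `i ≥ 1`, and the cokernel of `d 0` is isomorphic to `M`. -/
structure IsFreeResolution {R : Type u} [CommRing R] (M : Type v) [AddCommGroup M] [Module R M]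
    (F : ℕ → Type w) [∀ i, AddCommGroup (F i)] [∀ i, Module R (F i)]
    (d : ∀ i, F (i + 1) →ₗ[R] F i) : Prop where
  free : ∀ i, Module.Free R (F i)
  finite : ∀ i, Module.Finite R (F i)
  bounded : ∃ p, ∀ i, p < i → Subsingleton (F i)
  exact : ∀ i, Function.Exact (d (i + 1)) (d i)
  coker : Nonempty ((F 0 ⧸ LinearMap.range (d 0)) ≃ₗ[R] M)

/-- The maps `d i : F (i + 1) → F i` over `κ[x_1, …, x_r]` are minimal: the image of each of them lies
in `(x_1, …, x_r) F i`. -/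
def IsMinimal {κ : Type u} [Field κ] {r : ℕ} {F : ℕ → Type w} [∀ i, AddCommGroup (F i)]
    [∀ i, Module (MvPolynomial (Fin r) κ) (F i)]
    (d : ∀ i, F (i + 1) →ₗ[MvPolynomial (Fin r) κ] F i) : Prop :=
  ∀ i, LinearMap.range (d i) ≤
    Ideal.span (Set.range (X : Fin r → MvPolynomial (Fin r) κ)) •
      (⊤ : Submodule (MvPolynomial (Fin r) κ) (F i))

end Resolutions

/-- A simplicial complex with vertex set `V` whose vertices are labeled with monomials in `r`
variables. -/
structure LabeledComplex (V : Type*) (r : ℕ) where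
  complex : AbstractSimplicialComplex V
  label : V → (Fin r →₀ ℕ)

namespace LabeledComplex

variable {V : Type*} {r : ℕ}

/-- The faces, including the empty face (which Mathlib's simplicial complexes leave out). -/
def IsFace (Δ : LabeledComplex V r) (τ : Finset V) : Prop :=
  τ = ∅ ∨ τ ∈ Δ.complex.faces

theorem IsFace.subset {Δ : LabeledComplex V r} {σ τ : Finset V} (hτ : Δ.IsFace τ) (h : σ ⊆ τ) :
    Δ.IsFace σ := by
  rcases σ.eq_empty_or_nonempty with rfl | hσ
  · exact Or.inl rfl
  · rcases hτ with rfl | hτ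
    · exact Or.inl (Finset.subset_empty.mp h)
    · exact Or.inr ((Δ.complex.isRelLowerSet_faces hτ).2 h hσ)

/-- The label of a face: the lcm of the labels of its vertices. -/
def faceLabel (Δ : LabeledComplex V r) (τ : Finset V) : Fin r →₀ ℕ :=
  τ.sup Δ.label

/-- `Δ_{≤ u}`, as a set of faces. -/
def subcomplexLE (Δ : LabeledComplex V r) (u : Fin r →₀ ℕ) : Set (Finset V) :=
  {τ | Δ.IsFace τ ∧ Δ.faceLabel τ ≤ u}

/-- `Δ_{< u}`, as a set of faces. -/
def subcomplexLT (Δ : LabeledComplex V r) (u : Fin r →₀ ℕ) : Set (Finset V) :=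
  {τ | Δ.IsFace τ ∧ Δ.faceLabel τ ≤ u ∧ Δ.faceLabel τ ≠ u}

/-- The same simplicial complex, with the vertex label `n` replaced by `m`. -/
def relabel (Δ : LabeledComplex V r) (n m : Fin r →₀ ℕ) : LabeledComplex V r where
  complex := Δ.complex
  label v := open Classical in if Δ.label v = n then m else Δ.label v

/-- The vertices of `Δ` are labeled with (monomial) generators of `I`. -/
def IsLabeledBy {κ : Type*} [Field κ] (Δ : LabeledComplex V r)
    (I : Ideal (MvPolynomial (Fin r) κ)) : Prop :=
  Ideal.span (Set.range fun v => monomial (Δ.label v) (1 : κ)) = I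

/-- The faces with exactly `i` vertices, i.e. of dimension `i - 1`. -/
abbrev FaceOfCard (Δ : LabeledComplex V r) (i : ℕ) : Type _ :=
  {τ : Finset V // Δ.IsFace τ ∧ τ.card = i}

/-- The face obtained by removing the vertex `v` of `τ`. -/
def FaceOfCard.erase [DecidableEq V] {Δ : LabeledComplex V r} {i : ℕ} (τ : Δ.FaceOfCard (i + 1))
    (v : V) (hv : v ∈ τ.1) : Δ.FaceOfCard i :=
  ⟨τ.1.erase v, τ.2.1.subset (Finset.erase_subset v τ.1), by
    rw [Finset.card_erase_of_mem hv, τ.2.2, Nat.add_sub_cancel]⟩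

/-- The module in homological degree `i` of the homogenized chain complex of `Δ`: the free
`S`-module on the faces with `i` vertices (so it is `S` for `i = 0`). -/
abbrev Chains (Δ : LabeledComplex V r) (κ : Type*) [Field κ] (i : ℕ) : Type _ :=
  Δ.FaceOfCard i →₀ MvPolynomial (Fin r) κ

/-- The sign of `v` in the boundary of the face `τ`, namely `(-1)^j` if `v` is the `j`-th vertex of
`τ`, counted from `0`, in the order of `V`. -/
def faceSign [LinearOrder V] (τ : Finset V) (v : V) : ℤ :=
  (-1) ^ (τ.filter (· < v)).card

/-- The differential of the homogenized (augmented) simplicial chain complex of `Δ`: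
`e_τ ↦ ∑_{v ∈ τ} ± (lcm(τ) / lcm(τ ∖ v)) e_{τ ∖ v}`. -/
def differential [LinearOrder V] (Δ : LabeledComplex V r) (κ : Type*) [Field κ] (i : ℕ) :
    Δ.Chains κ (i + 1) →ₗ[MvPolynomial (Fin r) κ] Δ.Chains κ i :=
  Finsupp.linearCombination (MvPolynomial (Fin r) κ) fun τ : Δ.FaceOfCard (i + 1) =>
    ∑ v ∈ τ.1.attach, Finsupp.single (τ.erase v.1 v.2)
      (monomial (Δ.faceLabel τ.1 - Δ.faceLabel (τ.1.erase v.1)) (faceSign τ.1 v.1 : κ))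

/-- `Δ` supports a free resolution of `I`: its homogenized chain complex is a free resolution of
`S / I`. -/
def SupportsFreeResolution {κ : Type*} [Field κ] [LinearOrder V] (Δ : LabeledComplex V r)
    (I : Ideal (MvPolynomial (Fin r) κ)) : Prop :=
  IsFreeResolution (MvPolynomial (Fin r) κ ⧸ I) (Δ.Chains κ) (Δ.differential κ)

/-- `Δ` supports a minimal free resolution of `I`. -/
def SupportsMinimalFreeResolution {κ : Type*} [Field κ] [LinearOrder V] (Δ : LabeledComplex V r)
    (I : Ideal (MvPolynomial (Fin r) κ)) : Prop :=
  Δ.SupportsFreeResolution I ∧ IsMinimal (Δ.differential κ)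

end LabeledComplex

end MonomialResolution

end

noncomputable section

namespace MonomialResolution

open MvPolynomial

namespace LabeledComplex

variable {V : Type*} {r : ℕ}

/-! Let `g = gcd(I)`. Where `n` exceeds `g`, `m` is at least `n`; elsewhere `n = g`. So a common
multiple of `g` and `m` is a multiple of `n` (`le_of_gcdIdeal_le_of_le`), while `m` itself is not a
multiple of `g`. Every label of `Δ` is a multiple of `g`, so relabeling changes the lcm only of
nonempty faces whose vertices are all labeled `n`.

The homogenized complex splits by multidegree, and its strand in degree `u` is the augmented chain
complex of `Δ_{≤u}` over `κ` (`exact_differential_iff`). The cokernel in degree `0` is always `S`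
modulo the labels, so supporting a resolution means that all strands are exact. If `m ∤ u` or `n ∣
u`, then `Δ_{≤u} = Γ_{≤u}`. Otherwise `Δ_{≤u}` is `{∅}`, which imposes nothing, and `Γ_{≤u} =
Δ_{≤n}` (`forall_exactIn_relabel_iff`).

Minimality says that deleting a vertex always changes the face label;
`faceLabel_erase_eq_iff_relabel` transfers this. -/

theorem faceLabel_mono (Δ : LabeledComplex V r) {σ τ : Finset V} (h : σ ⊆ τ) :
    Δ.faceLabel σ ≤ Δ.faceLabel τ :=
  Finset.sup_mono h

/-! ### Multigraded components of the homogenized complex. -/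

variable {κ : Type*} [Field κ]

/-- The chain `z` is a combination of members of `F` of cardinality `i`. -/
def IsChainIn (F : Set (Finset V)) (i : ℕ) (z : Finset V →₀ κ) : Prop :=
  ∀ τ ∈ z.support, τ ∈ F ∧ τ.card = i

theorem isChainIn_induction {F : Set (Finset V)} {i : ℕ} {p : (Finset V →₀ κ) → Prop}
    {z : Finset V →₀ κ} (hz : IsChainIn F i z) (zero : p 0)
    (add : ∀ x y, p x → p y → p (x + y))
    (single : ∀ τ ∈ F, τ.card = i → ∀ c, p (Finsupp.single τ c)) : p z := by
  rw [← Finsupp.sum_single z]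
  exact Finset.sum_induction _ p add zero fun τ hτ => single τ (hz τ hτ).1 (hz τ hτ).2 _

variable (κ) (Δ : LabeledComplex V r)

open Classical in
/-- The component of multidegree `u` of a chain of the homogenized complex. -/
def component (u : Fin r →₀ ℕ) (i : ℕ) : Δ.Chains κ i →+ (Finset V →₀ κ) :=
  Finsupp.liftAddHom fun τ =>
    if Δ.faceLabel τ.1 ≤ u then
      (Finsupp.singleAddHom τ.1).comp (coeffAddMonoidHom (u - Δ.faceLabel τ.1))
    else 0

open Classical in
/-- The homogenization in multidegree `u` of a chain. -/
def homogenize (u : Fin r →₀ ℕ) (i : ℕ) : (Finset V →₀ κ) →+ Δ.Chains κ i :=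
  Finsupp.liftAddHom fun τ =>
    if h : Δ.IsFace τ ∧ τ.card = i then
      (Finsupp.singleAddHom (⟨τ, h⟩ : Δ.FaceOfCard i)).comp
        (monomial (R := κ) (u - Δ.faceLabel τ)).toAddMonoidHom
    else 0

open Classical in
theorem component_single (u : Fin r →₀ ℕ) {i : ℕ} (τ : Δ.FaceOfCard i) (s : Fin r →₀ ℕ) (c : κ) :
    Δ.component κ u i (Finsupp.single τ (monomial s c)) =
      if Δ.faceLabel τ.1 + s = u then Finsupp.single τ.1 c else 0 := by
  rw [component, Finsupp.liftAddHom_apply_single]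
  by_cases h : Δ.faceLabel τ.1 ≤ u
  · obtain ⟨t, rfl⟩ := exists_add_of_le h
    simp only [if_pos h, AddMonoidHom.comp_apply, add_right_inj]
    change Finsupp.single τ.1 (coeff (Δ.faceLabel τ.1 + t - Δ.faceLabel τ.1) (monomial s c)) = _
    rw [add_tsub_cancel_left, coeff_monomial]
    split_ifs <;> simp
  · rw [if_neg h, if_neg]
    · rfl
    · rintro rfl
      exact h le_self_add

theorem homogenize_single (u : Fin r →₀ ℕ) {i : ℕ} (τ : Δ.FaceOfCard i) (c : κ) :
    Δ.homogenize κ u i (Finsupp.single τ.1 c) =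
      Finsupp.single τ (monomial (u - Δ.faceLabel τ.1) c) := by
  rw [homogenize, Finsupp.liftAddHom_apply_single, dif_pos τ.2]
  rfl

theorem chains_induction {i : ℕ} {p : Δ.Chains κ i → Prop} (y : Δ.Chains κ i)
    (zero : p 0) (add : ∀ x y, p x → p y → p (x + y))
    (single : ∀ τ s c, p (Finsupp.single τ (monomial s c))) : p y := by
  induction y using Finsupp.induction_linear with
  | zero => exact zero
  | add f g hf hg => exact add f g hf hg
  | single τ q =>
    induction q using MvPolynomial.induction_on' with
    | monomial s c => exact single τ s c
    | add a b ha hb => rw [Finsupp.single_add]; exact add _ _ ha hb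

theorem homogenize_component_single (u : Fin r →₀ ℕ) {i : ℕ} (τ : Δ.FaceOfCard i)
    (s : Fin r →₀ ℕ) (c : κ) [Decidable (Δ.faceLabel τ.1 + s = u)] :
    Δ.homogenize κ u i (Δ.component κ u i (Finsupp.single τ (monomial s c))) =
      if Δ.faceLabel τ.1 + s = u then Finsupp.single τ (monomial s c) else 0 := by
  rw [component_single]
  split_ifs with h
  · rw [homogenize_single, ← h, add_tsub_cancel_left]
  · simp

/-- A chain of the homogenized complex is the sum of its multigraded components. -/
theorem exists_eq_sum_homogenize_component {i : ℕ} (y : Δ.Chains κ i) :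
    ∃ T : Finset (Fin r →₀ ℕ), ∀ T', T ⊆ T' →
      y = ∑ u ∈ T', Δ.homogenize κ u i (Δ.component κ u i y) := by
  classical
  induction y using chains_induction with
  | zero => exact ⟨∅, by simp⟩
  | add x y hx hy =>
    obtain ⟨A, hA⟩ := hx
    obtain ⟨B, hB⟩ := hy
    refine ⟨A ∪ B, fun T hT => ?_⟩
    simp only [map_add, Finset.sum_add_distrib]
    rw [← hA T (Finset.union_subset_left hT), ← hB T (Finset.union_subset_right hT)]
  | single τ s c =>
    refine ⟨{Δ.faceLabel τ.1 + s}, fun T hT => ?_⟩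
    simp only [homogenize_component_single]
    rw [Finset.sum_ite_eq, if_pos (hT (Finset.mem_singleton_self _))]

theorem isChainIn_component (u : Fin r →₀ ℕ) (i : ℕ) (y : Δ.Chains κ i) :
    IsChainIn (Δ.subcomplexLE u) i (Δ.component κ u i y) := by
  classical
  induction y using chains_induction with
  | zero => simp [IsChainIn]
  | add x y hx hy =>
    intro τ hτ
    rw [map_add] at hτ
    rcases Finset.mem_union.mp (Finsupp.support_add hτ) with h | h
    exacts [hx τ h, hy τ h]
  | single τ s c =>
    intro σ hσ
    rw [component_single] at hσ
    split_ifs at hσ with h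
    · obtain rfl := Finset.mem_singleton.mp (Finsupp.support_single_subset hσ)
      exact ⟨⟨τ.2.1, h ▸ le_self_add⟩, τ.2.2⟩
    · simp at hσ

/-- The exponent `u - lcm(τ)` is a truncated subtraction, faithful only when `lcm(τ) ∣ u`; hence the
restriction to chains on `Δ_{≤u}`. -/
theorem component_homogenize (u : Fin r →₀ ℕ) (i : ℕ) {z : Finset V →₀ κ}
    (hz : IsChainIn (Δ.subcomplexLE u) i z) :
    Δ.component κ u i (Δ.homogenize κ u i z) = z := by
  refine isChainIn_induction (p := fun z => Δ.component κ u i (Δ.homogenize κ u i z) = z) hz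
    (by simp) (fun x y hx hy => by simp only [map_add, hx, hy]) fun τ hτ hi c => ?_
  · rw [Δ.homogenize_single κ u ⟨τ, hτ.1, hi⟩, component_single,
      if_pos (add_tsub_cancel_of_le hτ.2)]

/-! ### Strands as simplicial chain complexes, exactness and minimality. -/

variable [LinearOrder V]

/-- The unlabeled simplicial boundary, on finite formal combinations of finite sets of vertices. -/
def boundary : (Finset V →₀ κ) →ₗ[κ] (Finset V →₀ κ) :=
  Finsupp.linearCombination κ fun τ : Finset V =>
    ∑ v ∈ τ.attach, Finsupp.single (τ.erase v.1) (faceSign τ v.1 : κ)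

theorem boundary_single (τ : Finset V) (c : κ) :
    boundary κ (Finsupp.single τ c) =
      ∑ v ∈ τ.attach, Finsupp.single (τ.erase v.1) (c * (faceSign τ v.1 : κ)) := by
  simp [boundary, Finsupp.linearCombination_single, Finset.smul_sum]

/-- The augmented chain complex of the set `F` of faces is exact at the chains on the faces with
`i + 1` vertices. -/
def ExactIn (F : Set (Finset V)) (i : ℕ) : Prop :=
  ∀ z : Finset V →₀ κ, IsChainIn F (i + 1) z →
    (boundary κ z = 0 ↔ ∃ w : Finset V →₀ κ, IsChainIn F (i + 2) w ∧ boundary κ w = z)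

/-- `ExactIn` starts at faces with one vertex, so the homology of `{∅}` at the empty face is not
seen. -/
theorem exactIn_of_forall_eq_empty {F : Set (Finset V)} (hF : ∀ τ ∈ F, τ = ∅) (i : ℕ) :
    ExactIn κ F i := by
  intro z hz
  have h0 : z = 0 := by
    rw [← Finsupp.support_eq_empty, Finset.eq_empty_iff_forall_notMem]
    intro τ hτ
    obtain ⟨h1, h2⟩ := hz τ hτ
    simp [hF τ h1] at h2
  subst h0
  exact ⟨fun _ => ⟨0, by simp [IsChainIn], by simp⟩, fun _ => by simp⟩

variable {κ} in
theorem isChainIn_boundary {u : Fin r →₀ ℕ} {i : ℕ} {z : Finset V →₀ κ}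
    (hz : IsChainIn (Δ.subcomplexLE u) (i + 1) z) :
    IsChainIn (Δ.subcomplexLE u) i (boundary κ z) := by
  classical
  intro σ hσ
  have : boundary κ z = ∑ τ ∈ z.support, boundary κ (Finsupp.single τ (z τ)) := by
    conv_lhs => rw [← Finsupp.sum_single z]
    rw [Finsupp.sum, map_sum]
  rw [this] at hσ
  obtain ⟨τ, hτ, h⟩ := Finset.mem_biUnion.mp (Finsupp.support_finsetSum hσ)
  rw [boundary_single] at h
  obtain ⟨v, -, h⟩ := Finset.mem_biUnion.mp (Finsupp.support_finsetSum h)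
  have h' := Finset.mem_singleton.mp (Finsupp.support_single_subset h)
  subst h'
  obtain ⟨⟨h1, h2⟩, h3⟩ := hz τ hτ
  have hs := Finset.erase_subset v.1 τ
  refine ⟨⟨h1.subset hs, (Δ.faceLabel_mono hs).trans h2⟩, ?_⟩
  rw [Finset.card_erase_of_mem v.2, h3, Nat.add_sub_cancel]

theorem differential_single {i : ℕ} (τ : Δ.FaceOfCard (i + 1)) (s : Fin r →₀ ℕ) (c : κ) :
    Δ.differential κ i (Finsupp.single τ (monomial s c)) =
      ∑ v ∈ τ.1.attach, Finsupp.single (τ.erase v.1 v.2)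
        (monomial (s + (Δ.faceLabel τ.1 - Δ.faceLabel (τ.1.erase v.1)))
          (c * (faceSign τ.1 v.1 : κ))) := by
  rw [differential, Finsupp.linearCombination_single, Finset.smul_sum]
  simp [monomial_mul]

/-- The coefficient `lcm(τ) / lcm(τ ∖ v)` is what makes the differential preserve multidegree;
within one degree only the sign remains. -/
theorem component_differential (u : Fin r →₀ ℕ) (i : ℕ) (y : Δ.Chains κ (i + 1)) :
    Δ.component κ u i (Δ.differential κ i y) = boundary κ (Δ.component κ u (i + 1) y) := by
  classical
  induction y using chains_induction with
  | zero => simp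
  | add x y hx hy => simp only [map_add, hx, hy]
  | single τ s c =>
    have hl (v : V) : Δ.faceLabel (τ.1.erase v) +
        (s + (Δ.faceLabel τ.1 - Δ.faceLabel (τ.1.erase v))) = Δ.faceLabel τ.1 + s := by
      rw [add_left_comm, add_tsub_cancel_of_le (Δ.faceLabel_mono (Finset.erase_subset v τ.1)),
        add_comm]
    rw [differential_single, map_sum, component_single]
    have (v : {x // x ∈ τ.1}) := Δ.component_single κ u (τ.erase v.1 v.2)
      (s + (Δ.faceLabel τ.1 - Δ.faceLabel (τ.1.erase v.1))) (c * (faceSign τ.1 v.1 : κ))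
    simp only [this]
    simp only [FaceOfCard.erase, hl]
    split_ifs
    · rw [boundary_single]
    · simp

theorem differential_homogenize (u : Fin r →₀ ℕ) (i : ℕ) {z : Finset V →₀ κ}
    (hz : IsChainIn (Δ.subcomplexLE u) (i + 1) z) :
    Δ.differential κ i (Δ.homogenize κ u (i + 1) z) = Δ.homogenize κ u i (boundary κ z) := by
  refine isChainIn_induction (p := fun z => Δ.differential κ i (Δ.homogenize κ u (i + 1) z) =
    Δ.homogenize κ u i (boundary κ z)) hz
    (by simp) (fun x y hx hy => by simp only [map_add, hx, hy]) fun τ hτ hi c => ?_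
  · rw [Δ.homogenize_single κ u ⟨τ, hτ.1, hi⟩, differential_single, boundary_single, map_sum]
    refine Finset.sum_congr rfl fun v _ => ?_
    have hle : Δ.faceLabel τ ≤ u := hτ.2
    have hadd : u - Δ.faceLabel τ + (Δ.faceLabel τ - Δ.faceLabel (τ.erase v.1)) =
        u - Δ.faceLabel (τ.erase v.1) :=
      tsub_add_tsub_cancel hle (Δ.faceLabel_mono (Finset.erase_subset v.1 τ))
    have := Δ.homogenize_single κ u
      (FaceOfCard.erase (⟨τ, hτ.1, hi⟩ : Δ.FaceOfCard (i + 1)) v.1 v.2)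
      (c * (faceSign τ v.1 : κ))
    refine Eq.trans ?_ this.symm
    change Finsupp.single _ (monomial (u - Δ.faceLabel τ +
      (Δ.faceLabel τ - Δ.faceLabel (τ.erase v.1))) _) = _
    rw [hadd]
    rfl

/-- The homogenized complex is exact if and only if all its multigraded strands are. -/
theorem exact_differential_iff (i : ℕ) :
    Function.Exact (Δ.differential κ (i + 1)) (Δ.differential κ i) ↔
      ∀ u, ExactIn κ (Δ.subcomplexLE u) i := by
  constructor
  · intro h u z hz
    -- Homogenization is injective on chains of `Δ_{≤u}`, having `component` as left inverse.
    have h1 : boundary κ z = 0 ↔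
        Δ.differential κ i (Δ.homogenize κ u (i + 1) z) = 0 := by
      rw [differential_homogenize κ Δ u i hz]
      refine ⟨fun h => by rw [h, map_zero], fun h => ?_⟩
      rw [← Δ.component_homogenize κ u i (isChainIn_boundary Δ hz), h, map_zero]
    rw [h1, h _]
    constructor
    · rintro ⟨y, hy⟩
      refine ⟨_, Δ.isChainIn_component κ u (i + 2) y, ?_⟩
      rw [← component_differential, hy, component_homogenize κ Δ u (i + 1) hz]
    · rintro ⟨w, hw, rfl⟩
      exact ⟨_, Δ.differential_homogenize κ u (i + 1) hw⟩
  · intro h y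
    constructor
    · intro hy
      have hu (u) : ∃ w : Finset V →₀ κ, IsChainIn (Δ.subcomplexLE u) (i + 2) w ∧
          boundary κ w = Δ.component κ u (i + 1) y := by
        rw [← h u _ (Δ.isChainIn_component κ u (i + 1) y), ← component_differential, hy, map_zero]
      -- A preimage is chosen in each multidegree; only the finitely many degrees in `T` are needed.
      choose w hw hwy using hu
      obtain ⟨T, hT⟩ := Δ.exists_eq_sum_homogenize_component κ y
      refine ⟨∑ u ∈ T, Δ.homogenize κ u (i + 2) (w u), ?_⟩
      rw [map_sum]
      refine (Finset.sum_congr rfl fun u _ => ?_).trans (hT T subset_rfl).symm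
      rw [← hwy, Δ.differential_homogenize κ u (i + 1) (hw u)]
    -- No sign computation is needed for `d ∘ d = 0`: the reverse implication in `ExactIn` already
    -- contains it for each strand.
    · rintro ⟨x, rfl⟩
      obtain ⟨T, hT⟩ := Δ.exists_eq_sum_homogenize_component κ
        (Δ.differential κ i (Δ.differential κ (i + 1) x))
      rw [hT T subset_rfl]
      refine Finset.sum_eq_zero fun u _ => ?_
      rw [component_differential, (h u _ (Δ.isChainIn_component κ u (i + 1) _)).2, map_zero]
      exact ⟨_, Δ.isChainIn_component κ u (i + 2) x, (Δ.component_differential κ u (i + 1) x).symm⟩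

/-- The homogenized complex is minimal if and only if removing a vertex from a face always changes
the label. -/
theorem isMinimal_differential_iff :
    IsMinimal (Δ.differential κ) ↔
      ∀ τ, Δ.IsFace τ → ∀ v ∈ τ, Δ.faceLabel (τ.erase v) ≠ Δ.faceLabel τ := by
  classical
  constructor
  · intro h τ hτ v hv heq
    obtain ⟨i, hi⟩ : ∃ i, τ.card = i + 1 :=
      Nat.exists_eq_succ_of_ne_zero (Finset.card_ne_zero_of_mem hv)
    let t : Δ.FaceOfCard (i + 1) := ⟨τ, hτ, hi⟩
    have hmem := h i (LinearMap.mem_range_self _ (Finsupp.single t (monomial 0 1)))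
    -- Elements of `(x_1, …, x_r) F` have coefficients without constant term, whereas an unchanged
    -- label produces the coefficient `±1`.
    have hker : ∀ x ∈ Ideal.span (Set.range (X : Fin r → MvPolynomial (Fin r) κ)) •
        (⊤ : Submodule (MvPolynomial (Fin r) κ) (Δ.Chains κ i)),
        ∀ σ, constantCoeff (x σ) = 0 := by
      intro x hx σ
      induction hx using Submodule.smul_induction_on' with
      | smul a ha b _ =>
        have : Ideal.span (Set.range (X : Fin r → MvPolynomial (Fin r) κ)) ≤
            RingHom.ker constantCoeff := by
          rw [Ideal.span_le]
          rintro _ ⟨j, rfl⟩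
          simp
        have ha' : constantCoeff a = 0 := this ha
        simp [ha']
      | add a _ b _ ha hb => simp [ha, hb]
    have h0 := hker _ hmem (t.erase v hv)
    rw [differential_single, Finsupp.finsetSum_apply, Finset.sum_eq_single ⟨v, hv⟩] at h0
    · rw [Finsupp.single_eq_same] at h0
      change constantCoeff (monomial (0 + (Δ.faceLabel τ - Δ.faceLabel (τ.erase v))) _) = 0 at h0
      rw [heq, tsub_self, add_zero, constantCoeff_eq, coeff_monomial, if_pos rfl] at h0
      simp [faceSign] at h0
    · rintro w - hw
      rw [Finsupp.single_eq_of_ne]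
      intro he
      apply hw
      exact Subtype.ext (Finset.erase_injOn τ w.2 hv (congrArg Subtype.val he).symm)
    · simp
  · intro h i
    rw [LinearMap.range_le_iff_comap, eq_top_iff]
    intro y _
    rw [Submodule.mem_comap]
    induction y using chains_induction with
    | zero => simp
    | add x y hx hy => rw [map_add]; exact add_mem (hx trivial) (hy trivial)
    | single τ s c =>
      rw [differential_single]
      refine sum_mem fun v _ => ?_
      have hne : s + (Δ.faceLabel τ.1 - Δ.faceLabel (τ.1.erase v.1)) ≠ 0 := by
        intro h0
        have h1 := (add_eq_zero.mp h0).2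
        exact h τ.1 τ.2.1 v.1 v.2 (le_antisymm (Δ.faceLabel_mono (Finset.erase_subset _ _))
          (tsub_eq_zero_iff_le.mp h1))
      rw [← mul_one (monomial _ _), ← smul_eq_mul, ← Finsupp.smul_single]
      refine Submodule.smul_mem_smul ?_ trivial
      rw [← Set.image_univ, mem_ideal_span_X_image]
      intro a ha
      obtain rfl := Finset.mem_singleton.mp (support_monomial_subset ha)
      obtain ⟨j, hj⟩ := Finsupp.ne_iff.mp hne
      exact ⟨j, trivial, hj⟩

end LabeledComplex

end MonomialResolution

end

noncomputable section

namespace MonomialResolution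

open MvPolynomial

namespace LabeledComplex

variable {V : Type*} {r : ℕ}

/-! ### Homological degree zero and the criterion for resolutions. -/

section Resolution

variable [LinearOrder V] {κ : Type*} [Field κ] (Δ : LabeledComplex V r)

instance uniqueFaceOfCardZero : Unique (Δ.FaceOfCard 0) where
  default := ⟨∅, Or.inl rfl, rfl⟩
  uniq τ := Subtype.ext (Finset.card_eq_zero.mp τ.2.2)

/-- In homological degree `0` the homogenized complex is the polynomial ring, and the image of the
differential is the ideal generated by the labels. -/
theorem map_range_differential_zero :
    (LinearMap.range (Δ.differential κ 0)).map
      (Finsupp.uniqueLinearEquiv (MvPolynomial (Fin r) κ) (MvPolynomial (Fin r) κ)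
        (default : Δ.FaceOfCard 0)).toLinearMap =
      Ideal.span (Set.range fun v => monomial (Δ.label v) (1 : κ)) := by
  rw [differential, Finsupp.range_linearCombination, Submodule.map_span, ← Set.range_comp,
    Ideal.span]
  have key (τ : Δ.FaceOfCard 1) (v : V) (hv : τ.1 = {v}) :
      (Finsupp.uniqueLinearEquiv (MvPolynomial (Fin r) κ) (MvPolynomial (Fin r) κ)
        (default : Δ.FaceOfCard 0)) (∑ v ∈ τ.1.attach, Finsupp.single (τ.erase v.1 v.2)
      (monomial (Δ.faceLabel τ.1 - Δ.faceLabel (τ.1.erase v.1)) (faceSign τ.1 v.1 : κ))) =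
      monomial (Δ.label v) (1 : κ) := by
    obtain ⟨t, ht⟩ := τ
    subst hv
    rw [Finsupp.uniqueLinearEquiv_apply, Finsupp.finsetSum_apply,
      Finset.sum_eq_single ⟨v, Finset.mem_singleton_self v⟩]
    · rw [Subsingleton.elim default (FaceOfCard.erase ⟨{v}, ht⟩ v (Finset.mem_singleton_self v)),
        Finsupp.single_eq_same]
      simp [faceLabel, faceSign, Finset.filter_singleton]
      exact tsub_zero _
    · rintro ⟨w, hw⟩ - h
      exact absurd (Subtype.ext (Finset.mem_singleton.mp hw)) h
    · simp
  congr 1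
  ext p
  constructor
  · rintro ⟨τ, rfl⟩
    obtain ⟨v, hv⟩ := Finset.card_eq_one.mp τ.2.2
    exact ⟨v, (key τ v hv).symm⟩
  · rintro ⟨v, rfl⟩
    -- Every element of `V` is a vertex of the complex, so every label is attained.
    exact ⟨⟨{v}, Or.inr (Δ.complex.singleton_mem v), rfl⟩,
      key ⟨{v}, Or.inr (Δ.complex.singleton_mem v), rfl⟩ v rfl⟩

variable {Δ} in
/-- A labeled complex supports a free resolution of the ideal generated by its labels if and only
if all multigraded strands of its homogenized complex are exact. -/
theorem supportsFreeResolution_iff [Finite V] {I : Ideal (MvPolynomial (Fin r) κ)}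
    (hΔ : Δ.IsLabeledBy I) :
    Δ.SupportsFreeResolution I ↔ ∀ i u, ExactIn κ (Δ.subcomplexLE u) i := by
  constructor
  · intro h i
    exact (Δ.exact_differential_iff κ i).mp (h.exact i)
  · intro h
    have := Fintype.ofFinite V
    refine ⟨fun i => inferInstance, fun i => inferInstance, ⟨Fintype.card V, fun i hi => ?_⟩,
      fun i => (Δ.exact_differential_iff κ i).mpr (h i), ⟨?_⟩⟩
    · have : IsEmpty (Δ.FaceOfCard i) :=
        ⟨fun τ => absurd (τ.2.2 ▸ Finset.card_le_univ τ.1) (not_le.mpr hi)⟩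
      infer_instance
    · exact Submodule.Quotient.equiv _ _ _ ((Δ.map_range_differential_zero).trans hΔ)

end Resolution

/-- An lcm divides `u` exactly when each label does, so `Δ_{≤u}` is determined by its vertices. -/
theorem subcomplexLE_congr {Δ Γ : LabeledComplex V r} (hc : Δ.complex = Γ.complex)
    {u u' : Fin r →₀ ℕ} (h : ∀ v, Δ.label v ≤ u ↔ Γ.label v ≤ u') :
    Δ.subcomplexLE u = Γ.subcomplexLE u' := by
  ext τ
  simp only [subcomplexLE, IsFace, faceLabel, Set.mem_ofPred_eq, hc, Finset.sup_le_iff, h]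

end LabeledComplex

/-! ### Divisibility and the lcm lattice after replacing `n` by `m`. -/

section Replacement

variable {κ : Type*} [Field κ] {r : ℕ} {I J : Ideal (MvPolynomial (Fin r) κ)}
  {n m : Fin r →₀ ℕ}

theorem gcdIdeal_le {a : Fin r →₀ ℕ} (ha : a ∈ monomialsOf I) : gcdIdeal I ≤ a := fun i => by
  have h : a i ∈ (fun u : Fin r →₀ ℕ => u i) '' monomialsOf I := ⟨a, ha, rfl⟩
  simpa [gcdIdeal] using Nat.sInf_le h

theorem monomialsOf_mono {a b : Fin r →₀ ℕ} (ha : a ∈ monomialsOf I) (hab : a ≤ b) :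
    b ∈ monomialsOf I := by
  have := I.mul_mem_left (monomial (b - a) (1 : κ)) ha
  rwa [monomial_mul, tsub_add_cancel_of_le hab, one_mul] at this

/-- A multiple of `gcd(I)` and of `m ∈ C_I(n)` is a multiple of `n`. -/
theorem le_of_gcdIdeal_le_of_le (hm : m ∈ CIdeal I n) {b : Fin r →₀ ℕ}
    (hb : gcdIdeal I ≤ b) (hmb : m ≤ b) : n ≤ b := fun i => by
  by_cases hi : i ∈ (n - gcdIdeal I).support
  · exact (hm.2.1 i hi).trans (hmb i)
  · have h1 : n i - gcdIdeal I i = 0 := by simpa using hi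
    exact (Nat.sub_eq_zero_iff_le.mp h1).trans (hb i)

theorem not_gcdIdeal_le (hm : m ∈ CIdeal I n) : ¬ gcdIdeal I ≤ m := fun h => by
  obtain ⟨i, hi, hlt⟩ := hm.2.2
  have h1 : n i - gcdIdeal I i = 0 := by simpa using hi
  exact absurd hlt (not_lt.mpr ((Nat.sub_eq_zero_iff_le.mp h1).trans (h i)))

theorem notMem_monomialsOf (hm : m ∈ CIdeal I n) : m ∉ monomialsOf I :=
  fun h => not_gcdIdeal_le hm (gcdIdeal_le h)

theorem eq_of_mem_monomialsOf_of_le (hn : n ∈ minGens I) {a : Fin r →₀ ℕ}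
    (ha : a ∈ monomialsOf I) (h : a ≤ n) : a = n :=
  le_antisymm h (hn.2 ha h)

theorem mem_monomialsOf_sup_iff (hI : IsMonomialIdeal I) {u : Fin r →₀ ℕ} :
    u ∈ monomialsOf (I ⊔ Ideal.span {monomial m (1 : κ)}) ↔ u ∈ monomialsOf I ∨ m ≤ u := by
  constructor
  · obtain ⟨A, rfl⟩ := hI
    intro hu
    have hu' : monomial u (1 : κ) ∈
        Ideal.span ((fun u => monomial u (1 : κ)) '' (A ∪ {m})) := by
      rw [Set.image_union, Ideal.span_union, Set.image_singleton]
      exact hu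
    obtain ⟨a, ha, hau⟩ := mem_ideal_span_monomial_image.mp hu' u (by simp)
    rcases ha with ha | rfl
    · exact Or.inl (monomialsOf_mono (Ideal.subset_span ⟨a, ha, rfl⟩) hau)
    · exact Or.inr hau
  · rintro (h | h)
    · exact Ideal.mem_sup_left h
    · exact monomialsOf_mono
        (Ideal.mem_sup_right (Ideal.mem_span_singleton_self _) : m ∈ monomialsOf _) h

/-- Adding `m ∈ C_I(n)` to `I` replaces the minimal generator `n` by `m`. -/
theorem mem_minGens_sup_iff (hI : IsMonomialIdeal I) (hn : n ∈ minGens I) (hm : m ∈ CIdeal I n)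
    (hmn : m ≤ n) {a : Fin r →₀ ℕ} :
    a ∈ minGens (I ⊔ Ideal.span {monomial m (1 : κ)}) ↔ a = m ∨ a ∈ minGens I ∧ a ≠ n := by
  have hJ {u : Fin r →₀ ℕ} := mem_monomialsOf_sup_iff (m := m) (u := u) hI
  have hne : m ≠ n := fun h => notMem_monomialsOf hm (h ▸ hn.1)
  constructor
  · intro ha
    by_cases ham : a = m
    · exact Or.inl ham
    have hma : ¬ m ≤ a := fun h => ham (le_antisymm (ha.2 (hJ.mpr (Or.inr le_rfl)) h) h)
    refine Or.inr ⟨⟨(hJ.mp ha.1).resolve_right hma, fun b hb hba => ha.2 (hJ.mpr (Or.inl hb)) hba⟩,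
      ?_⟩
    rintro rfl
    exact hma hmn
  · rintro (rfl | ⟨ha, han⟩)
    · refine ⟨hJ.mpr (Or.inr le_rfl), fun b hb hba => ?_⟩
      exact (hJ.mp hb).resolve_left fun h => notMem_monomialsOf hm (monomialsOf_mono h hba)
    · refine ⟨hJ.mpr (Or.inl ha.1), fun b hb hba => ?_⟩
      rcases hJ.mp hb with h | h
      · exact ha.2 h hba
      -- Here `m ∣ b ∣ a` and `a ∈ I`, so `n ∣ a`, and minimality of `a` gives `a = n`.
      · have hna := le_of_gcdIdeal_le_of_le hm (gcdIdeal_le ha.1) (h.trans hba)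
        exact absurd (eq_of_mem_monomialsOf_of_le ha hn.1 hna).symm han

theorem sup_eq_sup_of_gcdIdeal_le (hm : m ∈ CIdeal I n) (hmn : m ≤ n)
    {b : Fin r →₀ ℕ} (hb : gcdIdeal I ≤ b) : n ⊔ b = m ⊔ b :=
  le_antisymm (sup_le (le_of_gcdIdeal_le_of_le hm (hb.trans le_sup_right) le_sup_left)
    le_sup_right) (sup_le_sup_right hmn b)

theorem gcdIdeal_le_sup {A : Finset (Fin r →₀ ℕ)} (hA : (A : Set (Fin r →₀ ℕ)) ⊆ minGens I)
    (hne : A.Nonempty) : gcdIdeal I ≤ A.sup id := by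
  obtain ⟨a, ha⟩ := hne
  exact (gcdIdeal_le (hA ha).1).trans (Finset.le_sup (f := id) ha)

theorem lcmLattice_sdiff_eq (hI : IsMonomialIdeal I) (hn : n ∈ minGens I) (hm : m ∈ CIdeal I n)
    (hmn : m ≤ n) :
    lcmLattice I \ {n} = lcmLattice (I ⊔ Ideal.span {monomial m (1 : κ)}) \ {m} := by
  classical
  have hJ {a : Fin r →₀ ℕ} := mem_minGens_sup_iff (a := a) hI hn hm hmn
  have hne : m ≠ n := fun h => notMem_monomialsOf hm (h ▸ hn.1)
  have hsub {A : Finset (Fin r →₀ ℕ)} {x : Fin r →₀ ℕ} :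
      A = A.erase x ∨ A = insert x (A.erase x) := by
    by_cases h : x ∈ A
    · exact Or.inr (Finset.insert_erase h).symm
    · exact Or.inl (Finset.erase_eq_of_notMem h).symm
  ext u
  constructor
  · rintro ⟨⟨A, hA, rfl⟩, hu⟩
    have hB : ((A.erase n : Finset _) : Set (Fin r →₀ ℕ)) ⊆ minGens I :=
      fun a ha => hA (Finset.mem_of_mem_erase ha)
    have hBJ : ((A.erase n : Finset _) : Set (Fin r →₀ ℕ)) ⊆
        minGens (I ⊔ Ideal.span {monomial m (1 : κ)}) :=
      fun a ha => hJ.mpr (Or.inr ⟨hB ha, Finset.ne_of_mem_erase ha⟩)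
    constructor
    · rcases hsub (A := A) (x := n) with h | h
      · exact ⟨A.erase n, hBJ, by rw [← h]⟩
      · refine ⟨insert m (A.erase n), ?_, ?_⟩
        · rw [Finset.coe_insert, Set.insert_subset_iff]
          exact ⟨hJ.mpr (Or.inl rfl), hBJ⟩
        -- If `n` were the only element, the lcm would be the excluded `n`. Another generator makes
        -- the remaining lcm a multiple of `gcd(I)`, so `n` and `m` become interchangeable.
        · have hBne : (A.erase n).Nonempty := by
            rw [Finset.nonempty_iff_ne_empty]
            intro h0
            rw [h0] at h
            exact hu (by simp [h])
          conv_rhs => rw [h]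
          rw [Finset.sup_insert, Finset.sup_insert]
          exact (sup_eq_sup_of_gcdIdeal_le hm hmn (gcdIdeal_le_sup hB hBne)).symm
    · intro hum
      rw [Set.mem_singleton_iff] at hum
      rcases A.eq_empty_or_nonempty with rfl | hAne
      · exact hm.1 hum.symm
      · exact not_gcdIdeal_le hm (hum ▸ gcdIdeal_le_sup hA hAne)
  · rintro ⟨⟨A, hA, rfl⟩, hu⟩
    have hB : ((A.erase m : Finset _) : Set (Fin r →₀ ℕ)) ⊆ minGens I := fun a ha =>
      ((hJ.mp (hA (Finset.mem_of_mem_erase ha))).resolve_left (Finset.ne_of_mem_erase ha)).1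
    constructor
    · rcases hsub (A := A) (x := m) with h | h
      · exact ⟨A.erase m, hB, by rw [← h]⟩
      · refine ⟨insert n (A.erase m), ?_, ?_⟩
        · rw [Finset.coe_insert, Set.insert_subset_iff]
          exact ⟨hn, hB⟩
        · have hBne : (A.erase m).Nonempty := by
            rw [Finset.nonempty_iff_ne_empty]
            intro h0
            rw [h0] at h
            exact hu (by simp [h])
          conv_rhs => rw [h]
          rw [Finset.sup_insert, Finset.sup_insert]
          exact sup_eq_sup_of_gcdIdeal_le hm hmn (gcdIdeal_le_sup hB hBne)
    · intro hun
      rw [Set.mem_singleton_iff] at hun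
      -- A generator of `I` dividing `n` is `n`, which is no longer available; so an lcm equal to
      -- `n` could only involve `m`.
      have hAm : ∀ a ∈ A, a = m := fun a ha => by
        refine (hJ.mp (hA ha)).resolve_right fun h => h.2 ?_
        exact eq_of_mem_monomialsOf_of_le hn h.1.1 (hun ▸ Finset.le_sup (f := id) ha)
      have h1 : A.sup id ≤ m := Finset.sup_le fun a ha => (hAm a ha).le
      exact hne (le_antisymm hmn (hun ▸ h1))

/-- An element of the lcm lattice of `I` that is a multiple of `m` is a multiple of `n`. -/
theorem le_of_mem_lcmLattice (hm : m ∈ CIdeal I n) {u : Fin r →₀ ℕ}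
    (hu : u ∈ lcmLattice I) (hmu : m ≤ u) : n ≤ u := by
  obtain ⟨A, hA, rfl⟩ := hu
  rcases A.eq_empty_or_nonempty with rfl | hAne
  -- The element `1 = lcm(∅)` need not be a multiple of `gcd(I)`; it is handled by `m ≠ 1`.
  · exact absurd (le_antisymm hmu bot_le) hm.1
  · exact le_of_gcdIdeal_le_of_le hm (gcdIdeal_le_sup hA hAne) hmu

/-! ### Comparison of the complex with its relabeling. -/

namespace LabeledComplex

variable {V : Type*} {Δ : LabeledComplex V r}

theorem relabel_label_of_eq {v : V} (h : Δ.label v = n) : (Δ.relabel n m).label v = m := by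
  simp [relabel, h]

theorem relabel_label_of_ne {v : V} (h : Δ.label v ≠ n) :
    (Δ.relabel n m).label v = Δ.label v := by
  simp [relabel, h]

theorem IsLabeledBy.label_mem (hΔ : Δ.IsLabeledBy I) (v : V) : Δ.label v ∈ monomialsOf I := by
  change monomial (Δ.label v) (1 : κ) ∈ I
  rw [← hΔ]
  exact Ideal.subset_span ⟨v, rfl⟩

/-- Some label divides `n`, and minimality forces equality. This ensures that `m` really occurs
after relabeling. -/
theorem IsLabeledBy.exists_label_eq (hΔ : Δ.IsLabeledBy I) (hn : n ∈ minGens I) :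
    ∃ v, Δ.label v = n := by
  have h : monomial n (1 : κ) ∈
      Ideal.span ((fun u => monomial u (1 : κ)) '' Set.range Δ.label) := by
    rw [← Set.range_comp]
    exact hΔ.symm ▸ hn.1
  obtain ⟨_, ⟨v, rfl⟩, hv⟩ := mem_ideal_span_monomial_image.mp h n (by simp)
  exact ⟨v, eq_of_mem_monomialsOf_of_le hn (hΔ.label_mem v) hv⟩

theorem IsLabeledBy.relabel (hΔ : Δ.IsLabeledBy I) (hn : n ∈ minGens I) (hmn : m ≤ n) :
    (Δ.relabel n m).IsLabeledBy (I ⊔ Ideal.span {monomial m (1 : κ)}) := by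
  apply le_antisymm
  · rw [Ideal.span_le]
    rintro _ ⟨v, rfl⟩
    by_cases h : Δ.label v = n
    · simp only [relabel_label_of_eq h]
      exact Ideal.mem_sup_right (Ideal.subset_span rfl)
    · simp only [relabel_label_of_ne h]
      exact Ideal.mem_sup_left (hΔ.label_mem v)
  · have hmem : m ∈ monomialsOf
        (Ideal.span (Set.range fun v => monomial ((Δ.relabel n m).label v) (1 : κ))) := by
      obtain ⟨v, hv⟩ := hΔ.exists_label_eq hn
      exact Ideal.subset_span ⟨v, by simp only [relabel_label_of_eq hv]⟩
    refine sup_le ?_ (by rwa [Ideal.span_singleton_le_iff_mem])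
    conv_lhs => rw [← hΔ]
    rw [Ideal.span_le]
    rintro _ ⟨v, rfl⟩
    by_cases h : Δ.label v = n
    · simp only [h]
      exact monomialsOf_mono hmem hmn
    · exact Ideal.subset_span ⟨v, by simp only [relabel_label_of_ne h]⟩

theorem relabel_label_le_iff {u : Fin r →₀ ℕ} (hmn : m ≤ n) (hu : m ≤ u → n ≤ u) (v : V) :
    Δ.label v ≤ u ↔ (Δ.relabel n m).label v ≤ u := by
  by_cases h : Δ.label v = n
  · rw [relabel_label_of_eq h, h]
    exact ⟨hmn.trans, hu⟩
  · rw [relabel_label_of_ne h]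

theorem faceLabel_relabel_le (hmn : m ≤ n) (τ : Finset V) :
    (Δ.relabel n m).faceLabel τ ≤ Δ.faceLabel τ := by
  refine Finset.sup_mono_fun fun v _ => ?_
  by_cases h : Δ.label v = n
  · rw [relabel_label_of_eq h, h]
    exact hmn
  · rw [relabel_label_of_ne h]

/-- A face with a vertex not labeled `n` has the same label in both complexes. -/
theorem faceLabel_relabel_of_exists (hΔ : Δ.IsLabeledBy I)
    (hm : m ∈ CIdeal I n) (hmn : m ≤ n) {τ : Finset V} (h : ∃ v ∈ τ, Δ.label v ≠ n) :
    (Δ.relabel n m).faceLabel τ = Δ.faceLabel τ := by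
  refine le_antisymm (faceLabel_relabel_le hmn τ) (Finset.sup_le fun v hv => ?_)
  obtain ⟨w, hw, hwn⟩ := h
  have hle (x : V) (hx : x ∈ τ) : (Δ.relabel n m).label x ≤ (Δ.relabel n m).faceLabel τ :=
    Finset.le_sup (f := (Δ.relabel n m).label) hx
  by_cases hvn : Δ.label v = n
  · rw [hvn]
    refine le_of_gcdIdeal_le_of_le hm ?_ ((relabel_label_of_eq hvn).ge.trans (hle v hv))
    exact (gcdIdeal_le (hΔ.label_mem w)).trans ((relabel_label_of_ne hwn).ge.trans (hle w hw))
  · exact (relabel_label_of_ne hvn).ge.trans (hle v hv)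

theorem faceLabel_of_forall {τ : Finset V} (hτ : τ.Nonempty) {a : Fin r →₀ ℕ}
    (h : ∀ v ∈ τ, Δ.label v = a) : Δ.faceLabel τ = a := by
  rw [faceLabel, Finset.sup_congr rfl h, Finset.sup_const hτ]

theorem faceLabel_empty : Δ.faceLabel ∅ = 0 := Finset.sup_empty

theorem subcomplexLE_relabel {u : Fin r →₀ ℕ} (hmn : m ≤ n) (hu : m ≤ u → n ≤ u) :
    Δ.subcomplexLE u = (Δ.relabel n m).subcomplexLE u :=
  subcomplexLE_congr (Δ := Δ) (Γ := Δ.relabel n m) rfl (relabel_label_le_iff hmn hu)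

theorem subcomplexLT_relabel (hΔ : Δ.IsLabeledBy I)
    (hm : m ∈ CIdeal I n) (hmn : m ≤ n) {u : Fin r →₀ ℕ} (hu : u ∈ lcmLattice I) (hun : u ≠ n) :
    Δ.subcomplexLT u = (Δ.relabel n m).subcomplexLT u := by
  have hLE := subcomplexLE_relabel (Δ := Δ) hmn (le_of_mem_lcmLattice hm hu)
  have hLT (Γ : LabeledComplex V r) (τ : Finset V) :
      τ ∈ Γ.subcomplexLT u ↔ τ ∈ Γ.subcomplexLE u ∧ Γ.faceLabel τ ≠ u := and_assoc.symm
  ext τ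
  rw [hLT, hLT, hLE]
  refine and_congr_right fun hτ => not_congr ?_
  rw [← hLE] at hτ
  constructor
  · intro h
    rw [← h]
    rcases τ.eq_empty_or_nonempty with rfl | hne
    · rw [faceLabel_empty, faceLabel_empty]
    refine faceLabel_relabel_of_exists hΔ hm hmn ?_
    by_contra! hall
    exact hun (h ▸ faceLabel_of_forall hne hall)
  · intro h
    exact le_antisymm hτ.2 (h ▸ faceLabel_relabel_le hmn τ)

theorem forall_exactIn_relabel_iff [LinearOrder V] (hΔ : Δ.IsLabeledBy I) (hn : n ∈ minGens I)
    (hm : m ∈ CIdeal I n) (hmn : m ≤ n) (i : ℕ) :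
    (∀ u, ExactIn κ (Δ.subcomplexLE u) i) ↔
      ∀ u, ExactIn κ ((Δ.relabel n m).subcomplexLE u) i := by
  have hlabel {u : Fin r →₀ ℕ} (hmu : m ≤ u) (hnu : ¬ n ≤ u) (v : V) : ¬ Δ.label v ≤ u :=
    fun h => hnu (le_of_gcdIdeal_le_of_le hm ((gcdIdeal_le (hΔ.label_mem v)).trans h) hmu)
  constructor
  · intro h u
    by_cases hu : m ≤ u → n ≤ u
    · exact subcomplexLE_relabel (Δ := Δ) hmn hu ▸ h u
    · obtain ⟨hmu, hnu⟩ := Classical.not_imp.mp hu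
      -- Both sides consist of the faces all of whose vertices were labeled `n`.
      have heq : Δ.subcomplexLE n = (Δ.relabel n m).subcomplexLE u := by
        refine subcomplexLE_congr (Δ := Δ) (Γ := Δ.relabel n m) rfl fun v => ?_
        by_cases hv : Δ.label v = n
        · rw [relabel_label_of_eq hv, hv]
          exact iff_of_true le_rfl hmu
        · rw [relabel_label_of_ne hv]
          exact iff_of_false
            (fun h => hv (eq_of_mem_monomialsOf_of_le hn (hΔ.label_mem v) h)) (hlabel hmu hnu v)
      exact heq ▸ h n
  · intro h u
    by_cases hu : m ≤ u → n ≤ u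
    · exact (subcomplexLE_relabel (Δ := Δ) hmn hu).symm ▸ h u
    · obtain ⟨hmu, hnu⟩ := Classical.not_imp.mp hu
      -- No label of `Δ` divides `u`: it would give `gcd(I) ∣ u`, and with `m ∣ u` also `n ∣ u`.
      refine exactIn_of_forall_eq_empty κ (fun τ hτ => ?_) i
      rw [Finset.eq_empty_iff_forall_notMem]
      exact fun v hv => hlabel hmu hnu v ((Finset.le_sup (f := Δ.label) hv).trans hτ.2)

theorem faceLabel_erase_eq_iff_relabel [DecidableEq V] (hΔ : Δ.IsLabeledBy I)
    (hn : n ∈ minGens I) (hm : m ∈ CIdeal I n) (hmn : m ≤ n) {τ : Finset V} {v : V}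
    (hv : v ∈ τ) :
    Δ.faceLabel (τ.erase v) = Δ.faceLabel τ ↔
      (Δ.relabel n m).faceLabel (τ.erase v) = (Δ.relabel n m).faceLabel τ := by
  have hn0 : n ≠ 0 := fun h => hm.1 (le_antisymm (h ▸ hmn) bot_le)
  have hall {σ : Finset V} (hne : σ.Nonempty) (h : ∀ w ∈ σ, Δ.label w = n) :
      Δ.faceLabel σ = n ∧ (Δ.relabel n m).faceLabel σ = m :=
    ⟨faceLabel_of_forall hne h, faceLabel_of_forall hne fun w hw => relabel_label_of_eq (h w hw)⟩
  by_cases h1 : ∃ w ∈ τ.erase v, Δ.label w ≠ n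
  · rw [faceLabel_relabel_of_exists hΔ hm hmn h1, faceLabel_relabel_of_exists hΔ hm hmn
      (h1.imp fun w hw => ⟨Finset.mem_of_mem_erase hw.1, hw.2⟩)]
  push Not at h1
  by_cases h2 : ∃ w ∈ τ, Δ.label w ≠ n
  · have hτ := faceLabel_relabel_of_exists hΔ hm hmn h2
    rcases (τ.erase v).eq_empty_or_nonempty with h0 | hne
    · rw [hτ, h0, faceLabel_empty, faceLabel_empty]
    · obtain ⟨w, hw, hwn⟩ := h2
      have hwle : Δ.label w ≤ Δ.faceLabel τ := Finset.le_sup (f := Δ.label) hw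
      obtain ⟨ha, hb⟩ := hall hne h1
      rw [hτ, ha, hb]
      -- Equality would make the label of `w` divide `n`, hence equal `n`, or divide `m`, putting
      -- `m` in `I`.
      refine iff_of_false (fun h => ?_) fun h => ?_
      · exact hwn (eq_of_mem_monomialsOf_of_le hn (hΔ.label_mem w) (h ▸ hwle))
      · exact notMem_monomialsOf hm (monomialsOf_mono (hΔ.label_mem w) (h ▸ hwle))
  · push Not at h2
    obtain ⟨ha, hb⟩ := hall ⟨v, hv⟩ h2
    rw [ha, hb]
    rcases (τ.erase v).eq_empty_or_nonempty with h0 | hne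
    · rw [h0, faceLabel_empty, faceLabel_empty]
      exact iff_of_false hn0.symm hm.1.symm
    · obtain ⟨hc, hd⟩ := hall hne h1
      rw [hc, hd]
      exact iff_of_true rfl rfl

end LabeledComplex

end Replacement

end MonomialResolution

end

open MonomialResolution in
theorem theorem4p10 {κ : Type*} [Field κ] {r : ℕ} {V : Type*} [Finite V] [LinearOrder V]
    (I : Ideal (MvPolynomial (Fin r) κ)) (hI : IsMonomialIdeal I)
    (n m : Fin r →₀ ℕ) (hn : n ∈ minGens I) (hm : m ∈ CIdeal I n) (hmn : m ≤ n)
    (Δ : LabeledComplex V r) (hΔ : Δ.IsLabeledBy I)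
    (Γ : LabeledComplex V r) (hΓ : Γ = Δ.relabel n m)
    (J : Ideal (MvPolynomial (Fin r) κ))
    (hJ : J = I ⊔ Ideal.span {MvPolynomial.monomial m (1 : κ)}) :
    lcmLattice I \ {n} = lcmLattice J \ {m} ∧
    (∀ u ∈ lcmLattice I \ {n},
      Δ.subcomplexLE u = Γ.subcomplexLE u ∧ Δ.subcomplexLT u = Γ.subcomplexLT u) ∧
    (Δ.SupportsFreeResolution I ↔ Γ.SupportsFreeResolution J) ∧
    (Δ.SupportsMinimalFreeResolution I ↔ Γ.SupportsMinimalFreeResolution J) := by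
  subst hΓ hJ
  have hfree : Δ.SupportsFreeResolution I ↔ (Δ.relabel n m).SupportsFreeResolution
      (I ⊔ Ideal.span {MvPolynomial.monomial m (1 : κ)}) := by
    rw [LabeledComplex.supportsFreeResolution_iff hΔ,
      LabeledComplex.supportsFreeResolution_iff (hΔ.relabel hn hmn)]
    exact forall_congr' (LabeledComplex.forall_exactIn_relabel_iff hΔ hn hm hmn)
  refine ⟨lcmLattice_sdiff_eq hI hn hm hmn, fun u hu =>
    ⟨LabeledComplex.subcomplexLE_relabel hmn (le_of_mem_lcmLattice hm hu.1),
      LabeledComplex.subcomplexLT_relabel hΔ hm hmn hu.1 hu.2⟩, hfree, and_congr hfree ?_⟩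
  rw [LabeledComplex.isMinimal_differential_iff, LabeledComplex.isMinimal_differential_iff]
  exact forall_congr' fun τ => imp_congr Iff.rfl <| forall₂_congr fun v hv =>
    not_congr (LabeledComplex.faceLabel_erase_eq_iff_relabel hΔ hn hm hmn hv)
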